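/- Let $k$ be an uncountable algebraically closed field, and let $A$ be an associative unital $k$-algebra that is countably generated as a $k$-algebra. Suppose that $A$ is just infinite over $k$, that is, $\dim_k A = \infty$ and every nonzero two-sided ideal of $A$ has finite codimension over $k$. Suppose also that $A$ is not PI, that is, no nonzero polynomial in noncommuting variables with coefficients in $k$ vanishes under all substitutions of elements of $A$ for its variables. Then $A$ is stably just infinite: for every field extension $K/k$, the $K$-algebra $A \otimes_k K$ is just infinite over $K$. -/

import Mathlib

open scoped TensorProduct

universe w u v

/-- A `k`-algebra `A` is countably generated if it is generated, as a unital `k`-algebra, by a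
countable subset. -/
def IsCountablyGeneratedAlgebra (k : Type u) (A : Type v) [Field k] [Ring A] [Algebra k A] :
    Prop :=
  ∃ s : Set A, s.Countable ∧ Algebra.adjoin k s = ⊤

/-- A `k`-algebra `A` is PI (satisfies a polynomial identity) if some nonzero noncommutative
polynomial over `k` vanishes under every substitution of elements of `A` for its variables. -/
def IsPIAlgebra (k : Type u) (A : Type v) [Field k] [Ring A] [Algebra k A] : Prop :=
  ∃ f : FreeAlgebra k ℕ, f ≠ 0 ∧ ∀ a : ℕ → A, FreeAlgebra.lift k a f = 0

/-- A `k`-algebra `A` is just infinite if it is infinite dimensional over `k` and each of its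
nonzero two-sided ideals has finite codimension. -/
def IsJustInfinite (k : Type u) (A : Type v) [Field k] [Ring A] [Algebra k A] : Prop :=
  ¬ Module.Finite k A ∧
    ∀ I : Ideal A, I.IsTwoSided → I ≠ ⊥ → Module.Finite k (A ⧸ I)

/-- A just infinite `k`-algebra `A` is stably just infinite if, for every field extension `K` of
`k`, the scalar extension of `A` to `K` is just infinite over `K`. The scalar extension is written
`K ⊗[k] A`, on which Mathlib's canonical `K`-algebra structure is the one through the left
factor. -/
def IsStablyJustInfinite (k : Type u) (A : Type v) [Field k] [Ring A] [Algebra k A] : Prop :=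
  IsJustInfinite k A ∧
    ∀ (K : Type w) [Field K] [Algebra k K], IsJustInfinite K (K ⊗[k] A)

/-! The point is that every bimodule homomorphism `F` from a nonzero ideal `I` to `A` is a scalar
(`exists_eq_smul`). If not, each `(F - c)(I)` is a nonzero ideal, so it has finite codimension, and
uncountably many `c` share one codimension `n`. As `A` is not PI, some value `x ≠ 0` of a standard
polynomial lies in all of these ideals. The preimages `(F - c)⁻¹ x` are linearly independent, as
resolvents of a transcendental element are (`linearIndependent`), against the countable dimension of
`A`. Given scalarity, a nonzero ideal of `K ⊗[k] A` contains `1 ⊗ I` for some nonzero ideal `I` of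
`A` (`exists_ideal_one_tmul_mem`), so it has finite codimension. -/

/-! ### Standard polynomials and finite codimension -/

section StandardPolynomial

variable (k : Type u) [Field k] {A : Type v} [Ring A] [Algebra k A]

/-- The standard polynomial `∑ σ, sign σ • x (σ 0) * ⋯ * x (σ n)` in `n + 1` variables. -/
noncomputable def standardPolynomial (n : ℕ) : FreeAlgebra k ℕ :=
  MultilinearMap.alternatization (MultilinearMap.mkPiAlgebraFin k (n + 1) (FreeAlgebra k ℕ))
    fun i => FreeAlgebra.ι k (i : ℕ)

theorem lift_standardPolynomial (n : ℕ) (a : ℕ → A) :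
    FreeAlgebra.lift k a (standardPolynomial k n) =
      MultilinearMap.alternatization (MultilinearMap.mkPiAlgebraFin k (n + 1) A)
        fun i => a (i : ℕ) := by
  simp [standardPolynomial, MultilinearMap.alternatization_apply, map_list_prod, List.map_ofFn,
    Function.comp_def]

theorem prod_ofFn_single_of (n : ℕ) (f : Fin n → ℕ) :
    (List.ofFn fun i => MonoidAlgebra.single (FreeMonoid.of (f i)) (1 : k)).prod =
      MonoidAlgebra.single (FreeMonoid.ofList (List.ofFn f)) 1 := by
  induction n with
  | zero => rfl
  | succ n ih =>
    rw [List.ofFn_succ, List.prod_cons, ih, MonoidAlgebra.single_mul_single, List.ofFn_succ,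
      FreeMonoid.ofList_cons, one_mul]

/-- Only the identity permutation contributes to the coefficient of the word `0, 1, …, n`. -/
theorem standardPolynomial_ne_zero (n : ℕ) : standardPolynomial k n ≠ 0 := by
  intro h
  have h1 := lift_standardPolynomial k n
    fun i => MonoidAlgebra.single (FreeMonoid.of i) (1 : k)
  rw [h, map_zero, MultilinearMap.alternatization_apply] at h1
  have h2 := congrArg (fun p : MonoidAlgebra k (FreeMonoid ℕ) =>
    p.coeff (FreeMonoid.ofList (List.ofFn fun i : Fin (n + 1) => (i : ℕ)))) h1
  simp only [MultilinearMap.domDomCongr_apply, MultilinearMap.mkPiAlgebraFin_apply,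
    prod_ofFn_single_of, MonoidAlgebra.coeff_sum, Finsupp.finsetSum_apply] at h2
  rw [Finset.sum_eq_single 1] at h2
  · simp at h2
  · intro σ _ hσ
    have : FreeMonoid.ofList (List.ofFn fun i => ((σ i : Fin (n + 1)) : ℕ)) ≠
        FreeMonoid.ofList (List.ofFn fun i : Fin (n + 1) => (i : ℕ)) := by
      intro he
      apply hσ
      ext i
      exact congrFun (List.ofFn_injective (FreeMonoid.ofList.injective he)) i
    rw [Units.smul_def, MonoidAlgebra.coeff_smul, Finsupp.smul_apply, MonoidAlgebra.coeff_single,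
      Finsupp.single_eq_of_ne this.symm, smul_zero]
  · simp

theorem lift_standardPolynomial_eq_zero [Module.Finite k A] (n : ℕ)
    (hn : Module.finrank k A ≤ n) (a : ℕ → A) :
    FreeAlgebra.lift k a (standardPolynomial k n) = 0 := by
  rw [lift_standardPolynomial]
  apply AlternatingMap.map_linearDependent
  intro hli
  have := hli.fintype_card_le_finrank
  simp at this
  omega

theorem lift_standardPolynomial_mem {I : Ideal A} [I.IsTwoSided] [Module.Finite k (A ⧸ I)] (n : ℕ)
    (hn : Module.finrank k (A ⧸ I) ≤ n) (a : ℕ → A) :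
    FreeAlgebra.lift k a (standardPolynomial k n) ∈ I := by
  rw [← Ideal.Quotient.eq_zero_iff_mem,
    ← lift_standardPolynomial_eq_zero k n hn fun i => Ideal.Quotient.mk I (a i)]
  have : (Ideal.Quotient.mkₐ k I).comp (FreeAlgebra.lift k a) =
      FreeAlgebra.lift k fun i => Ideal.Quotient.mk I (a i) := by
    ext i; simp
  exact DFunLike.congr_fun this _

end StandardPolynomial

/-! ### Primeness and countable dimension -/

section Prime

variable {k : Type u} [Field k] {A : Type v} [Ring A] [Algebra k A]

/-- Otherwise two nonzero ideals satisfy `I * J = 0`, and the product of their standard polynomials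
is an identity of `A`. -/
theorem eq_zero_or_eq_zero_of_forall_mul_mul_eq_zero (hPI : ¬ IsPIAlgebra k A)
    (hA : IsJustInfinite k A) {x y : A} (h : ∀ a, x * a * y = 0) : x = 0 ∨ y = 0 := by
  by_contra! hxy
  let I : Ideal A :=
    { carrier := {u | ∀ a, u * a * y = 0}
      add_mem' := fun hu hv a => by rw [add_mul, add_mul, hu, hv, add_zero]
      zero_mem' := fun a => by simp
      smul_mem' := fun c u hu a => by
        rw [smul_eq_mul, mul_assoc, mul_assoc, ← mul_assoc u, hu, mul_zero] }
  have hIt : I.IsTwoSided := ⟨fun {u} b hu a => by rw [mul_assoc u]; exact hu _⟩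
  have hI : I ≠ ⊥ := fun hb => hxy.1 (by
    have : x ∈ I := h
    simpa [hb] using this)
  let J : Ideal A :=
    { carrier := {v | ∀ u ∈ I, u * v = 0}
      add_mem' := fun hu hv a ha => by rw [mul_add, hu a ha, hv a ha, add_zero]
      zero_mem' := fun a _ => mul_zero a
      smul_mem' := fun c v hv u hu => by
        rw [smul_eq_mul, ← mul_assoc]; exact hv _ (I.mul_mem_right c hu) }
  have hJt : J.IsTwoSided := ⟨fun {v} b hv u hu => by rw [← mul_assoc, hv u hu, zero_mul]⟩
  have hJ : J ≠ ⊥ := fun hb => hxy.2 (by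
    have : y ∈ J := fun u hu => by simpa using hu 1
    simpa [hb] using this)
  have := hA.2 I hIt hI
  have := hA.2 J hJt hJ
  refine hPI ⟨standardPolynomial k (Module.finrank k (A ⧸ I)) *
    standardPolynomial k (Module.finrank k (A ⧸ J)),
    mul_ne_zero (standardPolynomial_ne_zero k _) (standardPolynomial_ne_zero k _), fun a => ?_⟩
  rw [map_mul]
  exact lift_standardPolynomial_mem (I := J) k _ le_rfl a _
    (lift_standardPolynomial_mem (I := I) k _ le_rfl a)

theorem IsCountablyGeneratedAlgebra.rank_le (h : IsCountablyGeneratedAlgebra k A) :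
    Module.rank k A ≤ Cardinal.aleph0 := by
  obtain ⟨s, hs, htop⟩ := h
  have := Algebra.rank_adjoin_le (R := k) s
  rw [htop] at this
  rw [← rank_top, ← Algebra.top_toSubmodule]
  exact this.trans (max_le hs.le_aleph0 le_rfl)

end Prime

/-! ### Partial bimodule endomorphisms are scalar -/

/-- `F` restricts to a homomorphism of `A`-bimodules from the ideal `I` to `A`. -/
structure IsBimoduleHomOn {k : Type u} [Field k] {A : Type v} [Ring A] [Algebra k A]
    (I : Ideal A) (F : Module.End k A) : Prop where
  map_mul_left : ∀ a, ∀ x ∈ I, F (a * x) = a * F x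
  map_mul_right : ∀ a, ∀ x ∈ I, F (x * a) = F x * a

/-- The elements on which `F` can be applied `m` times as a partial map defined on `I`. -/
def iterateDomain {k : Type u} [Field k] {A : Type v} [Ring A] [Algebra k A]
    (I : Ideal A) (F : Module.End k A) (m : ℕ) : Set A :=
  {z | ∀ j < m, (F ^ j) z ∈ I}

namespace IsBimoduleHomOn

open Polynomial

variable {k : Type u} [Field k] {A : Type v} [Ring A] [Algebra k A]
  {I : Ideal A} {F : Module.End k A}

theorem pow_mul_left (hF : IsBimoduleHomOn I F) {m : ℕ} {z : A} (hz : z ∈ iterateDomain I F m)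
    (a : A) {j : ℕ} (hj : j ≤ m) : (F ^ j) (a * z) = a * (F ^ j) z := by
  induction j with
  | zero => simp
  | succ j ih =>
    rw [pow_succ', Module.End.mul_apply, Module.End.mul_apply, ih (by omega),
      hF.map_mul_left _ _ (hz j (by omega))]

theorem pow_mul_right (hF : IsBimoduleHomOn I F) {m : ℕ} {z : A} (hz : z ∈ iterateDomain I F m)
    (a : A) {j : ℕ} (hj : j ≤ m) : (F ^ j) (z * a) = (F ^ j) z * a := by
  induction j with
  | zero => simp
  | succ j ih =>
    rw [pow_succ', Module.End.mul_apply, Module.End.mul_apply, ih (by omega),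
      hF.map_mul_right _ _ (hz j (by omega))]

theorem mul_left_mem_iterateDomain (hF : IsBimoduleHomOn I F) {m : ℕ} {z : A}
    (hz : z ∈ iterateDomain I F m) (a : A) : a * z ∈ iterateDomain I F m := fun j hj => by
  rw [hF.pow_mul_left hz a hj.le]
  exact I.mul_mem_left a (hz j hj)

theorem aeval_mul_left (hF : IsBimoduleHomOn I F) {m : ℕ} {z : A} (hz : z ∈ iterateDomain I F m)
    (a : A) {p : k[X]} (hp : p.natDegree ≤ m) : aeval F p (a * z) = a * aeval F p z := by
  rw [aeval_eq_sum_range, LinearMap.sum_apply, LinearMap.sum_apply, Finset.mul_sum]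
  refine Finset.sum_congr rfl fun j hj => ?_
  rw [LinearMap.smul_apply, LinearMap.smul_apply, mul_smul_comm,
    hF.pow_mul_left hz a (by simp at hj; omega)]

theorem aeval_mem {m : ℕ} {z : A} (hz : z ∈ iterateDomain I F m) {p : k[X]}
    (hp : p.natDegree < m) : aeval F p z ∈ I := by
  rw [aeval_eq_sum_range, LinearMap.sum_apply]
  refine I.sum_mem fun j hj => ?_
  rw [LinearMap.smul_apply, Algebra.smul_def]
  exact I.mul_mem_left _ (hz j (by simp at hj; omega))

/-- By primeness some `u * a * v` is nonzero; one application of `F` acts on `v`, the others on `u`.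
-/
theorem exists_mem_iterateDomain [I.IsTwoSided] (hF : IsBimoduleHomOn I F)
    (hprime : ∀ x y : A, (∀ a, x * a * y = 0) → x = 0 ∨ y = 0) (hI : I ≠ ⊥) (m : ℕ) :
    ∃ z ∈ iterateDomain I F m, z ≠ 0 := by
  obtain ⟨v, hv, hv0⟩ := I.ne_bot_iff.1 hI
  induction m with
  | zero => exact ⟨v, fun j hj => by omega, hv0⟩
  | succ m ih =>
    obtain ⟨u, hu, hu0⟩ := ih
    have : ∃ a, u * a * v ≠ 0 := by
      by_contra! h
      exact (hprime u v h).elim hu0 hv0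
    obtain ⟨a, ha⟩ := this
    refine ⟨u * a * v, fun j hj => ?_, ha⟩
    cases j with
    | zero => exact I.mul_mem_left _ hv
    | succ j =>
      rw [pow_succ, Module.End.mul_apply, hF.map_mul_left _ _ hv, mul_assoc,
        hF.pow_mul_right hu _ (by omega)]
      exact I.mul_mem_right _ (hu j (by omega))

/-- For `y ∈ I`, `(F y - c • y) * a * x = y * a * (F x - c • x)`, so primeness makes `F - c`
injective on `I`. -/
theorem eq_zero_of_map_eq_smul [I.IsTwoSided] (hF : IsBimoduleHomOn I F)
    (hprime : ∀ x y : A, (∀ a, x * a * y = 0) → x = 0 ∨ y = 0)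
    (hns : ∀ c : k, ∃ x ∈ I, F x ≠ c • x) {c : k} {x : A} (hx : x ∈ I) (hxc : F x = c • x) :
    x = 0 := by
  obtain ⟨y, hy, hyc⟩ := hns c
  refine (hprime (F y - c • y) x fun a => ?_).resolve_left (sub_ne_zero.2 hyc)
  rw [sub_mul, ← hF.map_mul_right a y hy, sub_mul,
    ← hF.map_mul_right x _ (I.mul_mem_right a hy), hF.map_mul_left _ _ hx, hxc]
  simp

/-- Over an algebraically closed field `p` splits, so linear factors, each injective on `I`, can be
stripped one at a time. -/
theorem eq_zero_of_aeval_eq_zero [IsAlgClosed k] [I.IsTwoSided] (hF : IsBimoduleHomOn I F)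
    (hprime : ∀ x y : A, (∀ a, x * a * y = 0) → x = 0 ∨ y = 0)
    (hns : ∀ c : k, ∃ x ∈ I, F x ≠ c • x) {m : ℕ} {z : A} (hz : z ∈ iterateDomain I F m)
    {p : k[X]} (hp : p.natDegree ≤ m) (hp0 : p ≠ 0) (hpz : aeval F p z = 0) : z = 0 := by
  induction m generalizing z p with
  | zero =>
    rw [eq_C_of_natDegree_le_zero hp] at hpz hp0
    have h : p.coeff 0 • z = 0 := by simpa [Algebra.algebraMap_eq_smul_one] using hpz
    exact (smul_eq_zero.1 h).resolve_left (by simpa using hp0)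
  | succ m ih =>
    by_cases hd : p.natDegree = 0
    · refine ih (fun j hj => hz j (by omega)) (by omega) hp0 hpz
    · obtain ⟨μ, hμ⟩ := IsAlgClosed.exists_root p
        (fun h => hd (natDegree_eq_of_degree_eq_some h))
      obtain ⟨q, rfl⟩ := dvd_iff_isRoot.2 hμ
      have hq0 : q ≠ 0 := right_ne_zero_of_mul hp0
      rw [natDegree_mul (X_sub_C_ne_zero μ) hq0, natDegree_X_sub_C] at hp
      rw [mul_comm, map_mul, Module.End.mul_apply] at hpz
      have hX : aeval F (X - C μ) z = F z - μ • z := by simp [Algebra.algebraMap_eq_smul_one]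
      rw [hX] at hpz
      refine hF.eq_zero_of_map_eq_smul hprime hns (hz 0 (by omega))
        (sub_eq_zero.1 (ih (fun j hj => ?_) (by omega) hq0 hpz))
      rw [map_sub, map_smul, ← Module.End.mul_apply, ← pow_succ, Algebra.smul_def]
      exact I.sub_mem (hz _ (by omega)) (I.mul_mem_left _ (hz _ (by omega)))

theorem linearIndependent [IsAlgClosed k] [I.IsTwoSided] (hF : IsBimoduleHomOn I F)
    (hprime : ∀ x y : A, (∀ a, x * a * y = 0) → x = 0 ∨ y = 0) (hI : I ≠ ⊥)
    (hns : ∀ c : k, ∃ x ∈ I, F x ≠ c • x) {x : A} (hx : x ≠ 0) {Λ : Set k} (y : Λ → A)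
    (hyI : ∀ c, y c ∈ I) (hy : ∀ c, F (y c) - (c : k) • y c = x) : LinearIndependent k y := by
  classical
  rw [linearIndependent_iff']
  intro t b hb c hc
  obtain ⟨z, hz, hz0⟩ := hF.exists_mem_iterateDomain hprime hI t.card
  let g : Λ → k[X] := fun c => ∏ d ∈ t.erase c, (X - C (d : k))
  have hg : ∀ c ∈ t, (g c).natDegree < t.card := fun c hc => by
    rw [natDegree_prod_of_monic _ _ fun d _ => monic_X_sub_C _]
    simp [Finset.card_erase_of_mem hc]
    exact ⟨c, hc⟩
  have hgt : ∀ c ∈ t, (X - C (c : k)) * g c = ∏ d ∈ t, (X - C (d : k)) := fun c hc =>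
    Finset.mul_prod_erase t (fun d : Λ => X - C (d : k)) hc
  let h : k[X] := ∑ c ∈ t, C (b c) * g c
  have hdeg : h.natDegree ≤ t.card := natDegree_sum_le_of_forall_le _ _ fun c hc =>
    (natDegree_C_mul_le _ _).trans (hg c hc).le
  -- With `P = ∏ (X - d)` and `g c = P / (X - c)`, moving `F - c` across the product gives `x * g
  -- c(F) w = y c * P(F) w`.
  have key : ∀ w ∈ iterateDomain I F t.card, x * aeval F h w = 0 := by
    intro w hw
    have h1 : ∀ c ∈ t, x * aeval F (g c) w = y c * aeval F (∏ d ∈ t, (X - C (d : k))) w := by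
      intro c hc
      have hm := aeval_mem hw (hg c hc)
      rw [← hgt c hc, map_mul, Module.End.mul_apply, ← hy c, sub_mul,
        ← hF.map_mul_right _ _ (hyI c), hF.map_mul_left _ _ hm]
      simp [Algebra.algebraMap_eq_smul_one, mul_sub]
    rw [map_sum, LinearMap.sum_apply, Finset.mul_sum]
    calc ∑ c ∈ t, x * aeval F (C (b c) * g c) w
        = ∑ c ∈ t, (b c • y c) * aeval F (∏ d ∈ t, (X - C (d : k))) w := by
          refine Finset.sum_congr rfl fun c hc => ?_
          rw [smul_mul_assoc, ← h1 c hc, map_mul]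
          simp [Algebra.algebraMap_eq_smul_one]
      _ = 0 := by rw [← Finset.sum_mul, hb, zero_mul]
  have hhz : aeval F h z = 0 := by
    refine (hprime x _ fun a => ?_).resolve_left hx
    rw [mul_assoc, ← hF.aeval_mul_left hz a hdeg]
    exact key _ (hF.mul_left_mem_iterateDomain hz a)
  have h0 : h = 0 := by
    by_contra hne
    exact hz0 (hF.eq_zero_of_aeval_eq_zero hprime hns hz hdeg hne hhz)
  -- At `c` every `g d` with `d ≠ c` vanishes, which isolates `b c`.
  have he := congrArg (eval (c : k)) h0
  rw [eval_finsetSum, Finset.sum_eq_single c, eval_mul, eval_C, eval_zero, eval_prod] at he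
  · refine (mul_eq_zero.1 he).resolve_right (Finset.prod_ne_zero_iff.2 fun d hd => ?_)
    simpa [sub_eq_zero, Subtype.ext_iff, eq_comm] using Finset.ne_of_mem_erase hd
  · intro d _ hdc
    rw [eval_mul, eval_prod, Finset.prod_eq_zero (i := c) (by simp [hc, hdc.symm]) (by simp),
      mul_zero]
  · exact fun hn => (hn hc).elim

theorem exists_eq_smul [IsAlgClosed k] [Uncountable k] [I.IsTwoSided]
    (hF : IsBimoduleHomOn I F) (hgen : IsCountablyGeneratedAlgebra k A)
    (hPI : ¬ IsPIAlgebra k A) (hA : IsJustInfinite k A) (hI : I ≠ ⊥) :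
    ∃ c : k, ∀ x ∈ I, F x = c • x := by
  by_contra! hns
  have hprime : ∀ x y : A, (∀ a, x * a * y = 0) → x = 0 ∨ y = 0 := fun x y =>
    eq_zero_or_eq_zero_of_forall_mul_mul_eq_zero hPI hA
  let R : k → Ideal A := fun c =>
    { carrier := {u | ∃ y ∈ I, F y - c • y = u}
      add_mem' := by
        rintro _ _ ⟨y, hy, rfl⟩ ⟨z, hz, rfl⟩
        exact ⟨y + z, I.add_mem hy hz, by rw [map_add, smul_add]; abel⟩
      zero_mem' := ⟨0, I.zero_mem, by simp⟩
      smul_mem' := by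
        rintro a _ ⟨y, hy, rfl⟩
        exact ⟨a * y, I.mul_mem_left a hy, by
          rw [hF.map_mul_left _ _ hy, smul_eq_mul, mul_sub, mul_smul_comm]⟩ }
  have hRt : ∀ c, (R c).IsTwoSided := fun c => ⟨by
    rintro _ a ⟨y, hy, rfl⟩
    exact ⟨y * a, I.mul_mem_right a hy, by
      rw [hF.map_mul_right _ _ hy, sub_mul, smul_mul_assoc]⟩⟩
  have hRfin : ∀ c, Module.Finite k (A ⧸ R c) := fun c => by
    refine hA.2 (R c) (hRt c) fun hb => ?_
    obtain ⟨y, hy, hyc⟩ := hns c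
    have : F y - c • y ∈ R c := ⟨y, hy, rfl⟩
    rw [hb, Ideal.mem_bot, sub_eq_zero] at this
    exact hyc this
  have hn : ∃ n, ¬ {c : k | Module.finrank k (A ⧸ R c) = n}.Countable := by
    by_contra! hall
    have := Set.countable_iUnion hall
    refine Set.not_countable_univ (α := k) (this.mono fun c _ => ?_)
    simp
  obtain ⟨n, hn⟩ := hn
  have hex : ∃ a : ℕ → A, FreeAlgebra.lift k a (standardPolynomial k n) ≠ 0 := by
    by_contra! hall
    exact hPI ⟨_, standardPolynomial_ne_zero k n, hall⟩
  obtain ⟨a, ha⟩ := hex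
  have hmem : ∀ c : {c : k | Module.finrank k (A ⧸ R c) = n},
      FreeAlgebra.lift k a (standardPolynomial k n) ∈ R c := fun c =>
    lift_standardPolynomial_mem k n c.2.le a
  choose y hyI hy using hmem
  have hli := hF.linearIndependent hprime hI hns ha y hyI hy
  have hcard := hli.cardinal_lift_le_rank.trans (Cardinal.lift_le.2 hgen.rank_le)
  rw [Cardinal.lift_aleph0, Cardinal.lift_le_aleph0, Cardinal.mk_le_aleph0_iff] at hcard
  exact hn hcard

end IsBimoduleHomOn

/-! ### Ideals of the scalar extension -/

section BaseChange

variable {k : Type u} [Field k] {A : Type v} [Ring A] [Algebra k A]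
  {K : Type w} [Field K] [Algebra k K]

theorem equivFinsuppOfBasisLeft_one_tmul_mul {ι : Type*} [DecidableEq ι] (b : Module.Basis ι k K)
    (a : A) (t : K ⊗[k] A) (i : ι) :
    TensorProduct.equivFinsuppOfBasisLeft b ((1 ⊗ₜ[k] a) * t) i =
      a * TensorProduct.equivFinsuppOfBasisLeft b t i := by
  induction t with
  | zero => simp
  | add s t hs ht => simp [mul_add, hs, ht]
  | tmul κ c => simp

theorem equivFinsuppOfBasisLeft_mul_one_tmul {ι : Type*} [DecidableEq ι] (b : Module.Basis ι k K)
    (a : A) (t : K ⊗[k] A) (i : ι) :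
    TensorProduct.equivFinsuppOfBasisLeft b (t * (1 ⊗ₜ[k] a)) i =
      TensorProduct.equivFinsuppOfBasisLeft b t i * a := by
  induction t with
  | zero => simp
  | add s t hs ht => simp [add_mul, hs, ht]
  | tmul κ c => simp

theorem finite_quotient_of_one_tmul_mem {I : Ideal A} [Module.Finite k (A ⧸ I)]
    {L : Ideal (K ⊗[k] A)} (h : ∀ a ∈ I, (1 : K) ⊗ₜ[k] a ∈ L) :
    Module.Finite K ((K ⊗[k] A) ⧸ L) := by
  let φ : A →ₗ[k] (K ⊗[k] A) ⧸ L :=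
    (L.mkQ.restrictScalars k).comp (TensorProduct.mk k K A 1)
  let ψ : (A ⧸ I) →ₗ[k] (K ⊗[k] A) ⧸ L :=
    (I.restrictScalars k).liftQ φ fun a ha => (Submodule.Quotient.mk_eq_zero L).2 (h a ha)
  refine Module.Finite.of_surjective (ψ.liftBaseChange K) fun q => ?_
  obtain ⟨t, rfl⟩ := L.mkQ_surjective q
  induction t with
  | zero => exact ⟨0, by simp⟩
  | add s t hs ht =>
    obtain ⟨s', hs⟩ := hs
    obtain ⟨t', ht⟩ := ht
    exact ⟨s' + t', by rw [map_add, map_add, hs, ht]⟩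
  | tmul κ a =>
    refine ⟨κ ⊗ₜ[k] (Submodule.Quotient.mk a : A ⧸ I), ?_⟩
    rw [LinearMap.liftBaseChange_tmul]
    have : ψ (Submodule.Quotient.mk a) = L.mkQ (1 ⊗ₜ[k] a) := rfl
    rw [this, Submodule.mkQ_apply, Submodule.mkQ_apply, ← Submodule.Quotient.mk_smul,
      TensorProduct.smul_tmul', smul_eq_mul, mul_one]

/-- Every nonzero ideal of `K ⊗[k] A` meets `A` nontrivially if all bimodule homomorphisms from
nonzero ideals of `A` to `A` are scalar. -/
theorem exists_ideal_one_tmul_mem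
    (hscalar : ∀ (I : Ideal A) (F : Module.End k A), I.IsTwoSided → I ≠ ⊥ →
      IsBimoduleHomOn I F → ∃ c : k, ∀ x ∈ I, F x = c • x)
    {L : Ideal (K ⊗[k] A)} [L.IsTwoSided] (hL : L ≠ ⊥) :
    ∃ I : Ideal A, I.IsTwoSided ∧ I ≠ ⊥ ∧ ∀ a ∈ I, (1 : K) ⊗ₜ[k] a ∈ L := by
  classical
  let b := Module.Basis.ofVectorSpace k K
  let e := TensorProduct.equivFinsuppOfBasisLeft (N := A) b
  have hne : ∃ t, t ∈ L ∧ t ≠ 0 := L.ne_bot_iff.1 hL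
  -- Minimal support makes any coordinate `i₀` of `t₀` determine the elements of `L` supported
  -- inside that of `t₀`.
  obtain ⟨t₀, ⟨ht₀, ht₀0⟩, hmin⟩ :=
    WellFounded.has_min (measure fun t => (e t).support.card).wf {t | t ∈ L ∧ t ≠ 0} hne
  obtain ⟨i₀, hi₀⟩ : ∃ i, e t₀ i ≠ 0 := by
    by_contra! h
    exact ht₀0 (e.map_eq_zero_iff.1 (Finsupp.ext h))
  let M : Submodule k (K ⊗[k] A) :=
    L.restrictScalars k ⊓ (Finsupp.supported A k ((e t₀).support : Set _)).comap e.toLinearMap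
  have hM : ∀ t, t ∈ M ↔ t ∈ L ∧ ∀ i, e t₀ i = 0 → e t i = 0 := fun t => by
    simp only [M, Submodule.mem_inf, Submodule.restrictScalars_mem, Submodule.mem_comap,
      Finsupp.mem_supported']
    simp
  have hMl : ∀ a, ∀ t ∈ M, (1 ⊗ₜ[k] a) * t ∈ M := fun a t ht => by
    rw [hM] at ht ⊢
    exact ⟨L.mul_mem_left _ ht.1, fun i hi => by
      rw [equivFinsuppOfBasisLeft_one_tmul_mul, ht.2 i hi, mul_zero]⟩
  have hMr : ∀ a, ∀ t ∈ M, t * (1 ⊗ₜ[k] a) ∈ M := fun a t ht => by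
    rw [hM] at ht ⊢
    exact ⟨L.mul_mem_right _ ht.1, fun i hi => by
      rw [equivFinsuppOfBasisLeft_mul_one_tmul, ht.2 i hi, zero_mul]⟩
  let π : _ → M →ₗ[k] A := fun i => (Finsupp.lapply i).comp (e.toLinearMap.comp M.subtype)
  have hπ : ∀ i (t : M), π i t = e t i := fun _ _ => rfl
  have hker : LinearMap.ker (π i₀) = ⊥ := by
    rw [LinearMap.ker_eq_bot']
    intro t ht
    by_contra ht0
    have htM := (hM t).1 t.2
    refine hmin t ⟨htM.1, fun h => ht0 (Subtype.ext h)⟩ (Finset.card_lt_card ?_)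
    refine ⟨fun i hi => ?_, fun hs => ?_⟩
    · simp only [Finsupp.mem_support_iff] at hi ⊢
      exact fun h => hi (htM.2 i h)
    · exact (Finsupp.mem_support_iff.1 (hs (Finsupp.mem_support_iff.2 hi₀))) ht
  -- The `k`-linear `g` is defined on all of `A`, so `i₀`-coordinate ↦ `i`-coordinate becomes a
  -- total map; only its values on `I` matter.
  obtain ⟨g, hg⟩ := (π i₀).exists_leftInverse_of_injective hker
  have hgπ : ∀ i (t : M), ((π i).comp g) (π i₀ t) = e t i := fun i t => by
    rw [LinearMap.comp_apply, ← hπ i t]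
    exact congrArg (π i) (LinearMap.congr_fun hg t)
  let I : Ideal A :=
    { carrier := Set.range (π i₀)
      add_mem' := by
        rintro _ _ ⟨s, rfl⟩ ⟨t, rfl⟩
        exact ⟨s + t, map_add _ _ _⟩
      zero_mem' := ⟨0, map_zero _⟩
      smul_mem' := by
        rintro a _ ⟨t, rfl⟩
        exact ⟨⟨_, hMl a t t.2⟩, equivFinsuppOfBasisLeft_one_tmul_mul b a t i₀⟩ }
  have hIt : I.IsTwoSided := ⟨by
    rintro _ a ⟨t, rfl⟩
    exact ⟨⟨_, hMr a t t.2⟩, equivFinsuppOfBasisLeft_mul_one_tmul b a t i₀⟩⟩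
  have ht₀M : t₀ ∈ M := (hM t₀).2 ⟨ht₀, fun _ h => h⟩
  have hI : I ≠ ⊥ := I.ne_bot_iff.2 ⟨e t₀ i₀, ⟨⟨t₀, ht₀M⟩, rfl⟩, hi₀⟩
  have hF : ∀ i, IsBimoduleHomOn I ((π i).comp g) := fun i =>
    { map_mul_left := by
        rintro a _ ⟨t, rfl⟩
        have : a * π i₀ t = π i₀ ⟨_, hMl a t t.2⟩ :=
          (equivFinsuppOfBasisLeft_one_tmul_mul b a t i₀).symm
        rw [this, hgπ, hgπ]
        exact equivFinsuppOfBasisLeft_one_tmul_mul b a t i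
      map_mul_right := by
        rintro a _ ⟨t, rfl⟩
        have : π i₀ t * a = π i₀ ⟨_, hMr a t t.2⟩ :=
          (equivFinsuppOfBasisLeft_mul_one_tmul b a t i₀).symm
        rw [this, hgπ, hgπ]
        exact equivFinsuppOfBasisLeft_mul_one_tmul b a t i }
  choose c hc using fun i => hscalar I _ hIt hI (hF i)
  have hcoord : ∀ (t : M) i, e t i = c i • e t i₀ := fun t i => by
    have := hc i (π i₀ t) ⟨t, rfl⟩
    rwa [hgπ] at this
  -- All coordinates being scalar multiples of the `i₀`-th, each element of `M` is a pure tensor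
  -- with the same left factor `κ`.
  let κ : K := ∑ i ∈ (e t₀).support, c i • b i
  have hκ : ∀ t : M, (t : K ⊗[k] A) = κ ⊗ₜ[k] e t i₀ := fun t => by
    have hsupp : (e t).support ⊆ (e t₀).support := fun i hi => by
      simp only [Finsupp.mem_support_iff] at hi ⊢
      exact fun h => hi (((hM t).1 t.2).2 i h)
    calc (t : K ⊗[k] A) = (e t).sum fun i n => b i ⊗ₜ[k] n := by
          rw [← TensorProduct.equivFinsuppOfBasisLeft_symm_apply]
          exact (e.symm_apply_apply _).symm
      _ = ∑ i ∈ (e t₀).support, b i ⊗ₜ[k] e t i :=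
          Finsupp.sum_of_support_subset _ hsupp _ (by simp)
      _ = κ ⊗ₜ[k] e t i₀ := by
          rw [TensorProduct.sum_tmul]
          refine Finset.sum_congr rfl fun i _ => ?_
          rw [hcoord t i, TensorProduct.tmul_smul, TensorProduct.smul_tmul']
  have hκ0 : κ ≠ 0 := fun h => ht₀0 ((hκ ⟨t₀, ht₀M⟩).trans (by rw [h, TensorProduct.zero_tmul]))
  refine ⟨I, hIt, hI, ?_⟩
  rintro _ ⟨t, rfl⟩
  have : (1 : K) ⊗ₜ[k] π i₀ t = (κ⁻¹ ⊗ₜ[k] 1) * (t : K ⊗[k] A) := by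
    rw [hκ t, Algebra.TensorProduct.tmul_mul_tmul, inv_mul_cancel₀ hκ0, one_mul, hπ]
  rw [this]
  exact L.mul_mem_left _ ((hM t).1 t.2).1

end BaseChange

theorem mainTheorem7 (k : Type u) [Field k] [IsAlgClosed k] [Uncountable k]
    (A : Type v) [Ring A] [Algebra k A]
    (hgen : IsCountablyGeneratedAlgebra k A)
    (hPI : ¬ IsPIAlgebra k A)
    (hA : IsJustInfinite k A) :
    IsStablyJustInfinite.{w} k A := by
  refine ⟨hA, fun K _ _ => ⟨fun h => hA.1 ?_, fun L hLt hL => ?_⟩⟩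
  · exact Module.Finite.of_finite_tensorProduct_of_faithfullyFlat K
  · obtain ⟨I, hIt, hI, hIL⟩ := exists_ideal_one_tmul_mem (fun I F hIt hI hF =>
      hF.exists_eq_smul hgen hPI hA hI) hL
    have := hA.2 I hIt hI
    exact finite_quotient_of_one_tmul_mem hIL
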